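/- Let $X$ be a real locally convex space with topological dual $X^*$ and pairing $\langle x^*,x\rangle = x^*(x)$, and let $X^*$ carry any locally convex topology compatible with this duality (i.e. its continuous linear functionals are exactly the evaluations at points of $X$; for example the weak-$*$ topology). Let $T$ be a nonempty, possibly infinite index set, $c, a_t \in X^*$ and $b_t \in \mathbb{R}$ for $t \in T$, and consider the linear program $$\min\ \langle c, x\rangle \quad \text{subject to} \quad \langle a_t, x\rangle \le b_t \ \text{ for all } t \in T .$$ For a feasible point $x$ and $\varepsilon > 0$ put $$A_\varepsilon(x) := \overline{\operatorname{co}}\,\{\, s\,a_t : \langle a_t, x\rangle - b_t \ge -\varepsilon/s,\ t \in T,\ s > 0 \,\} \subset X^*,$$ the closed convex hull, and recall that the recession cone of a nonempty closed convex set $A$ is $[A]_\infty := \bigcap_{r>0} r(A - p)$, which does not depend on the choice of $p \in A$. Then a feasible point $x$ is optimal if and only if $$-c \in [A_\varepsilon(x)]_\infty \quad \text{for every } \varepsilon > 0,$$ or, equivalently, if and only if $$-c \in \bigcap_{\varepsilon > 0} A_\varepsilon(x).$$ -/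

import Mathlib

open scoped Pointwise Topology

/-- The recession cone `[A]_∞ = ⋂_{t > 0} t (A - a)`, with `a ∈ A`, and `[∅]_∞ = {0}`.
For a closed convex set `A` the intersection does not depend on `a ∈ A`
(see `recessionCone_eq_iInter`), so all points `a ∈ A` are used at once. -/
def recessionCone {E : Type*} [AddCommGroup E] [Module ℝ E] (A : Set E) : Set E :=
  {v | (A = ∅ → v = 0) ∧ ∀ a ∈ A, v ∈ ⋂ (t : ℝ) (_ : 0 < t), t • (A - {a})}

theorem mem_smul_sub_singleton_iff {E : Type*} [AddCommGroup E] [Module ℝ E] {A : Set E}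
    {a v : E} {t : ℝ} (ht : 0 < t) : v ∈ t • (A - {a}) ↔ a + t⁻¹ • v ∈ A := by
  rw [Set.mem_smul_set_iff_inv_smul_mem₀ ht.ne', Set.sub_singleton, Set.mem_image]
  constructor
  · rintro ⟨y, hy, h⟩
    rw [← h, add_sub_cancel]
    exact hy
  · intro h
    exact ⟨_, h, by abel⟩

/-- For a closed convex set the recession cone may be computed at an arbitrary point of it. -/
theorem recessionCone_eq_iInter {E : Type*} [AddCommGroup E] [Module ℝ E] [TopologicalSpace E]
    [IsTopologicalAddGroup E] [ContinuousSMul ℝ E] {A : Set E} (hA : Convex ℝ A)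
    (hcl : IsClosed A) {a₀ : E} (ha₀ : a₀ ∈ A) :
    recessionCone A = ⋂ (t : ℝ) (_ : 0 < t), t • (A - {a₀}) := by
  ext v
  constructor
  · exact fun h => h.2 a₀ ha₀
  · intro h
    refine ⟨fun he => absurd ha₀ (by simp [he]), fun a ha => ?_⟩
    simp only [Set.mem_iInter] at h ⊢
    intro t ht
    rw [mem_smul_sub_singleton_iff ht]
    have hlim : Filter.Tendsto
        (fun r : ℝ => (1 - r) • a + r • a₀ + t⁻¹ • v) (𝓝[>] 0) (𝓝 (a + t⁻¹ • v)) := by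
      have : Continuous (fun r : ℝ => (1 - r) • a + r • a₀ + t⁻¹ • v) := by fun_prop
      have h0 := this.tendsto 0
      simp only [sub_zero, one_smul, zero_smul, add_zero] at h0
      exact h0.mono_left nhdsWithin_le_nhds
    refine hcl.mem_of_tendsto hlim ?_
    filter_upwards [Ioo_mem_nhdsGT (zero_lt_one (α := ℝ))] with r hr
    have hr0 : 0 < r := hr.1
    have h1 := (mem_smul_sub_singleton_iff (mul_pos ht hr0)).1 (h (t * r) (mul_pos ht hr0))
    have h2 := hA ha h1 (by linarith [hr.2] : (0 : ℝ) ≤ 1 - r) hr0.le (by ring)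
    have h3 : r * (t * r)⁻¹ = t⁻¹ := by field_simp
    rwa [smul_add, smul_smul, h3, ← add_assoc] at h2

/-- `τ` is a locally convex vector topology on the dual `X*` compatible with the duality
`⟨x*, x⟩ = x* x` between `X*` and `X`: the `τ`-continuous linear functionals on `X*` are
exactly the evaluations at points of `X`. -/
structure IsDualCompatible {X : Type*} [AddCommGroup X] [Module ℝ X] [TopologicalSpace X]
    [IsTopologicalAddGroup X] [ContinuousSMul ℝ X]
    (τ : TopologicalSpace (X →L[ℝ] ℝ)) : Prop where
  isTopologicalAddGroup : @IsTopologicalAddGroup (X →L[ℝ] ℝ) τ _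
  continuousSMul : @ContinuousSMul ℝ (X →L[ℝ] ℝ) _ _ τ
  locallyConvexSpace : @LocallyConvexSpace ℝ (X →L[ℝ] ℝ) _ _ _ _ τ
  continuous_iff : ∀ φ : (X →L[ℝ] ℝ) →ₗ[ℝ] ℝ,
    Continuous[τ, inferInstance] φ ↔ ∃ x : X, ∀ f : X →L[ℝ] ℝ, φ f = f x

/-- The feasible set of the linear program `min ⟨c, x⟩` subject to `⟨a t, x⟩ ≤ b t`, `t ∈ T`. -/
def lpFeasible {X T : Type*} [AddCommGroup X] [Module ℝ X] [TopologicalSpace X]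
    (a : T → X →L[ℝ] ℝ) (b : T → ℝ) : Set X :=
  {x | ∀ t, a t x ≤ b t}

/-- `x` is an optimal solution of `min ⟨c, x⟩` subject to `⟨a t, x⟩ ≤ b t`, `t ∈ T`. -/
def IsLPOptimal {X T : Type*} [AddCommGroup X] [Module ℝ X] [TopologicalSpace X]
    (c : X →L[ℝ] ℝ) (a : T → X →L[ℝ] ℝ) (b : T → ℝ) (x : X) : Prop :=
  x ∈ lpFeasible a b ∧ ∀ y ∈ lpFeasible a b, c x ≤ c y

/-- The set `{s a_t : ⟨a_t, x⟩ - b_t ≥ -ε / s, t ∈ T, s > 0}`. -/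
def lpActiveSet {X T : Type*} [AddCommGroup X] [Module ℝ X] [TopologicalSpace X]
    [IsTopologicalAddGroup X] [ContinuousSMul ℝ X]
    (a : T → X →L[ℝ] ℝ) (b : T → ℝ) (x : X) (ε : ℝ) : Set (X →L[ℝ] ℝ) :=
  {f | ∃ (t : T) (s : ℝ), 0 < s ∧ a t x - b t ≥ -ε / s ∧ f = s • a t}

/-! By Hahn–Banach and compatibility, `g` lies in the closed hull of a set exactly when every bound
`f u ≤ α` on that set passes to `g`. If `α > 0` bounds the active set in direction `u`, then `x + (ε
/ α) • u` is feasible, so optimality forces `c u ≥ 0` and `-c` obeys the bound. Conversely, for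
feasible `y` the active set is bounded by `ε` at `y - x`, so `c x ≤ c y + ε` for every `ε`. For
recession cones, `0` lies in the hull, so membership means that all positive multiples of `-c` lie
in it; optimality survives scaling `c`. -/

theorem mem_closure_convexHull_iff_forall_le {E : Type*} [AddCommGroup E] [Module ℝ E]
    [TopologicalSpace E] [IsTopologicalAddGroup E] [ContinuousSMul ℝ E] [LocallyConvexSpace ℝ E]
    {D : Set E} {v : E} :
    v ∈ closure (convexHull ℝ D) ↔
      ∀ (φ : E →ₗ[ℝ] ℝ) (α : ℝ), Continuous φ → (∀ f ∈ D, φ f ≤ α) → φ v ≤ α := by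
  constructor
  · intro hv φ α hφ hD
    have hconv : Convex ℝ {f | φ f ≤ α} := convex_halfSpace_le φ.isLinear α
    exact closure_minimal (convexHull_min hD hconv) (isClosed_le hφ continuous_const) hv
  · intro h
    by_contra hv
    obtain ⟨φ, α, h1, h2⟩ := geometric_hahn_banach_closed_point
      (convex_convexHull ℝ D).closure isClosed_closure hv
    exact (h φ.toLinearMap α φ.continuous
      fun f hf => (h1 f (subset_closure (subset_convexHull ℝ D hf))).le).not_gt h2

theorem mem_recessionCone_closure_convexHull_iff {E : Type*} [AddCommGroup E] [Module ℝ E]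
    [TopologicalSpace E] [IsTopologicalAddGroup E] [ContinuousSMul ℝ E] {D : Set E}
    (h0 : 0 ∈ closure (convexHull ℝ D)) {v : E} :
    v ∈ recessionCone (closure (convexHull ℝ D)) ↔
      ∀ r : ℝ, 0 < r → r⁻¹ • v ∈ closure (convexHull ℝ D) := by
  rw [recessionCone_eq_iInter (convex_convexHull ℝ D).closure isClosed_closure h0]
  simp only [Set.mem_iInter]
  refine forall₂_congr fun r hr => ?_
  rw [mem_smul_sub_singleton_iff hr, zero_add]

theorem IsLPOptimal.smul {X T : Type*} [AddCommGroup X] [Module ℝ X] [TopologicalSpace X]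
    {c : X →L[ℝ] ℝ} {a : T → X →L[ℝ] ℝ} {b : T → ℝ} {x : X} (h : IsLPOptimal c a b x)
    {r : ℝ} (hr : 0 ≤ r) : IsLPOptimal (r • c) a b x :=
  ⟨h.1, fun y hy => mul_le_mul_of_nonneg_left (h.2 y hy) hr⟩

section

variable {X : Type*} [AddCommGroup X] [Module ℝ X] [TopologicalSpace X]
  [IsTopologicalAddGroup X] [ContinuousSMul ℝ X]

theorem IsDualCompatible.mem_closure_convexHull_iff {τ : TopologicalSpace (X →L[ℝ] ℝ)}
    (hτ : IsDualCompatible τ) {D : Set (X →L[ℝ] ℝ)} {g : X →L[ℝ] ℝ} :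
    g ∈ closure[τ] (convexHull ℝ D) ↔
      ∀ (u : X) (α : ℝ), (∀ f ∈ D, f u ≤ α) → g u ≤ α := by
  refine (@mem_closure_convexHull_iff_forall_le _ _ _ τ hτ.isTopologicalAddGroup
    hτ.continuousSMul hτ.locallyConvexSpace D g).trans ⟨fun h u α hD => ?_, fun h φ α hφ hD => ?_⟩
  · let φ : (X →L[ℝ] ℝ) →ₗ[ℝ] ℝ :=
      { toFun := fun f => f u
        map_add' := fun _ _ => rfl
        map_smul' := fun _ _ => rfl }
    exact h φ α ((hτ.continuous_iff φ).2 ⟨u, fun _ => rfl⟩) hD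
  · obtain ⟨u, hu⟩ := (hτ.continuous_iff φ).1 hφ
    rw [hu]
    exact h u α fun f hf => hu f ▸ hD f hf

variable {T : Type*} {a : T → X →L[ℝ] ℝ} {b : T → ℝ} {x : X} {ε : ℝ}

theorem mem_lpActiveSet_iff {f : X →L[ℝ] ℝ} :
    f ∈ lpActiveSet a b x ε ↔ ∃ (t : T) (s : ℝ), 0 < s ∧ s * (b t - a t x) ≤ ε ∧ f = s • a t := by
  refine exists_congr fun t => exists_congr fun s => and_congr_right fun hs => and_congr_left' ?_
  rw [ge_iff_le, div_le_iff₀ hs]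
  constructor <;> intro h <;> linarith

theorem lpActiveSet_nonempty [Nonempty T] (hx : x ∈ lpFeasible a b) (hε : 0 < ε) :
    (lpActiveSet a b x ε).Nonempty := by
  obtain ⟨t⟩ := ‹Nonempty T›
  have hr : 0 ≤ b t - a t x := sub_nonneg.2 (hx t)
  -- The `+ 1` keeps the denominator positive when the constraint is tight.
  refine ⟨_, mem_lpActiveSet_iff.2 ⟨t, ε / (b t - a t x + 1), by positivity, ?_, rfl⟩⟩
  rw [div_mul_eq_mul_div, div_le_iff₀ (by positivity)]
  nlinarith

theorem smul_mem_lpActiveSet {f : X →L[ℝ] ℝ} (hx : x ∈ lpFeasible a b)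
    (hf : f ∈ lpActiveSet a b x ε) {δ : ℝ} (hδ : 0 < δ) (hδ1 : δ ≤ 1) :
    δ • f ∈ lpActiveSet a b x ε := by
  obtain ⟨t, s, hs, hr, rfl⟩ := mem_lpActiveSet_iff.1 hf
  refine mem_lpActiveSet_iff.2 ⟨t, δ * s, mul_pos hδ hs, ?_, smul_smul _ _ _⟩
  rw [mul_assoc]
  exact (mul_le_of_le_one_left (mul_nonneg hs.le (sub_nonneg.2 (hx t))) hδ1).trans hr

/-- The support function of the sets `lpActiveSet` is nonnegative. -/
theorem nonneg_of_forall_mem_lpActiveSet_le [Nonempty T] (hx : x ∈ lpFeasible a b) (hε : 0 < ε)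
    {u : X} {α : ℝ} (h : ∀ f ∈ lpActiveSet a b x ε, f u ≤ α) : 0 ≤ α := by
  by_contra! hα
  obtain ⟨f, hf⟩ := lpActiveSet_nonempty hx hε
  have hk := h f hf
  have hneg : f u < 0 := hk.trans_lt hα
  -- Shrinking `f` by this factor gives the value `α / 2`, which exceeds `α` since `α < 0`.
  have hδ1 : α / (2 * f u) ≤ 1 := by
    rw [div_le_one_of_neg (by linarith)]
    linarith
  have h1 := h _ (smul_mem_lpActiveSet hx hf (div_pos_of_neg_of_neg hα (by linarith)) hδ1)
  have h2 : (α / (2 * f u)) * f u = α / 2 := by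
    rw [div_mul_eq_mul_div, mul_div_mul_right _ _ hneg.ne]
  rw [smul_apply, smul_eq_mul, h2] at h1
  linarith

theorem zero_mem_closure_convexHull_lpActiveSet [Nonempty T] {τ : TopologicalSpace (X →L[ℝ] ℝ)}
    (hτ : IsDualCompatible τ) (hx : x ∈ lpFeasible a b) (hε : 0 < ε) :
    0 ∈ closure[τ] (convexHull ℝ (lpActiveSet a b x ε)) :=
  hτ.mem_closure_convexHull_iff.2 fun _ _ h => nonneg_of_forall_mem_lpActiveSet_le hx hε h

/-- A bound `α` on the support function of `lpActiveSet` in direction `u` yields a feasible step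
of length `ε / α` in that direction. -/
theorem add_smul_mem_lpFeasible (hx : x ∈ lpFeasible a b) (hε : 0 < ε) {u : X} {α : ℝ}
    (hα : 0 < α) (h : ∀ f ∈ lpActiveSet a b x ε, f u ≤ α) : x + (ε / α) • u ∈ lpFeasible a b := by
  intro t
  rw [map_add, map_smul, smul_eq_mul]
  rcases (sub_nonneg.2 (hx t)).eq_or_lt with hr | hr
  -- At a tight constraint `s` is unrestricted, so a positive `a t u` could be scaled up to `α + 1`.
  · have hu : a t u ≤ 0 := by
      by_contra! hu
      have h1 := h _ (mem_lpActiveSet_iff.2 ⟨t, (α + 1) / a t u, by positivity,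
        by rw [← hr, mul_zero]; exact hε.le, rfl⟩)
      rw [smul_apply, smul_eq_mul, div_mul_cancel₀ _ hu.ne'] at h1
      linarith
    have := mul_nonpos_of_nonneg_of_nonpos (div_pos hε hα).le hu
    linarith
  -- With positive slack, the largest admissible `s` gives the sharpest bound on `a t u`.
  · have h1 := h _ (mem_lpActiveSet_iff.2 ⟨t, ε / (b t - a t x), div_pos hε hr,
      (div_mul_cancel₀ _ hr.ne').le, rfl⟩)
    rw [smul_apply, smul_eq_mul, div_mul_eq_mul_div, div_le_iff₀ hr] at h1
    have h2 : ε / α * a t u ≤ b t - a t x := by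
      rw [div_mul_eq_mul_div, div_le_iff₀ hα]
      linarith
    linarith

theorem IsLPOptimal.neg_mem_closure_convexHull [Nonempty T] {τ : TopologicalSpace (X →L[ℝ] ℝ)}
    (hτ : IsDualCompatible τ) {c : X →L[ℝ] ℝ} (h : IsLPOptimal c a b x) (hε : 0 < ε) :
    -c ∈ closure[τ] (convexHull ℝ (lpActiveSet a b x ε)) := by
  refine hτ.mem_closure_convexHull_iff.2 fun u α hu => ?_
  have hα := nonneg_of_forall_mem_lpActiveSet_le h.1 hε hu
  refine le_of_forall_pos_le_add fun δ hδ => ?_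
  -- `α` may be zero, while the step length `ε / (α + δ)` needs a positive denominator.
  have hαδ : 0 < α + δ := by linarith
  have hopt := h.2 _ (add_smul_mem_lpFeasible h.1 hε hαδ fun f hf => (hu f hf).trans (by linarith))
  rw [map_add, map_smul, smul_eq_mul, le_add_iff_nonneg_right] at hopt
  have := nonneg_of_mul_nonneg_right hopt (div_pos hε hαδ)
  rw [neg_apply]
  linarith

theorem isLPOptimal_of_forall_neg_mem {τ : TopologicalSpace (X →L[ℝ] ℝ)}
    (hτ : IsDualCompatible τ) {c : X →L[ℝ] ℝ} (hx : x ∈ lpFeasible a b)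
    (h : ∀ ε : ℝ, 0 < ε → -c ∈ closure[τ] (convexHull ℝ (lpActiveSet a b x ε))) :
    IsLPOptimal c a b x := by
  refine ⟨hx, fun y hy => le_of_forall_pos_le_add fun ε hε => ?_⟩
  have h1 := hτ.mem_closure_convexHull_iff.1 (h ε hε) (y - x) ε fun f hf => by
    obtain ⟨t, s, hs, hr, rfl⟩ := mem_lpActiveSet_iff.1 hf
    rw [smul_apply, smul_eq_mul, map_sub]
    exact (mul_le_mul_of_nonneg_left (sub_le_sub_right (hy t) _) hs.le).trans hr
  rw [neg_apply, map_sub] at h1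
  linarith

theorem recessionCone_closure_convexHull_lpActiveSet [Nonempty T]
    {τ : TopologicalSpace (X →L[ℝ] ℝ)} (hτ : IsDualCompatible τ) (hx : x ∈ lpFeasible a b)
    (hε : 0 < ε) {g : X →L[ℝ] ℝ} :
    g ∈ recessionCone (closure[τ] (convexHull ℝ (lpActiveSet a b x ε))) ↔
      ∀ r : ℝ, 0 < r → r⁻¹ • g ∈ closure[τ] (convexHull ℝ (lpActiveSet a b x ε)) :=
  @mem_recessionCone_closure_convexHull_iff _ _ _ τ hτ.isTopologicalAddGroup hτ.continuousSMul _
    (zero_mem_closure_convexHull_lpActiveSet hτ hx hε) _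

end

theorem mainTheorem7 {X : Type*} [AddCommGroup X] [Module ℝ X] [TopologicalSpace X]
    [IsTopologicalAddGroup X] [ContinuousSMul ℝ X] [LocallyConvexSpace ℝ X]
    (τ : TopologicalSpace (X →L[ℝ] ℝ)) (hτ : IsDualCompatible τ)
    {T : Type*} [Nonempty T] (c : X →L[ℝ] ℝ) (a : T → X →L[ℝ] ℝ) (b : T → ℝ)
    (x : X) (hx : x ∈ lpFeasible a b) :
    (IsLPOptimal c a b x ↔
      ∀ ε : ℝ, 0 < ε →
        -c ∈ recessionCone (closure[τ] (convexHull ℝ (lpActiveSet a b x ε)))) ∧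
    (IsLPOptimal c a b x ↔
      -c ∈ ⋂ (ε : ℝ) (_ : 0 < ε), closure[τ] (convexHull ℝ (lpActiveSet a b x ε))) := by
  have hmem : IsLPOptimal c a b x ↔
      ∀ ε : ℝ, 0 < ε → -c ∈ closure[τ] (convexHull ℝ (lpActiveSet a b x ε)) :=
    ⟨fun h _ hε => h.neg_mem_closure_convexHull hτ hε, isLPOptimal_of_forall_neg_mem hτ hx⟩
  refine ⟨⟨fun h ε hε => ?_, fun h => hmem.2 fun ε hε => ?_⟩, ?_⟩
  · refine (recessionCone_closure_convexHull_lpActiveSet hτ hx hε).2 fun r hr => ?_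
    rw [smul_neg]
    exact (h.smul (inv_nonneg.2 hr.le)).neg_mem_closure_convexHull hτ hε
  · simpa using (recessionCone_closure_convexHull_lpActiveSet hτ hx hε).1 (h ε hε) 1 one_pos
  · simpa only [Set.mem_iInter] using hmem
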